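/- **Setup (max-min grouped bandits).** There are $n$ arms $\{1,\dots,n\}$ and a known finite collection $\mathcal G$ of non-empty, possibly overlapping subsets (groups) of the arms, such that every arm is in at least one group. For each arm $j$, its successive rewards $X_{j,1},X_{j,2},\dots$ are drawn independently from a distribution with mean $\mu_j\in[0,1]$ that is sub-Gaussian with parameter $R\le\frac12$, i.e. $\mathbb E[e^{\lambda(X_{j,1}-\mu_j)}]\le e^{\lambda^2R^2/2}$ for all $\lambda\in\mathbb R$. Suppose that the max-min optimal group is unique: there is $G^*\in\mathcal G$ with $\min_{j\in G^*}\mu_j>\min_{j\in G}\mu_j$ for all $G\in\mathcal G$, $G\ne G^*$. Put $\Delta_G=\min_{i\in G^*}\mu_i-\min_{i\in G}\mu_i$ and, for each arm $j$, $$\Delta_j=\max\{\Delta_j',\Delta_j'',\Delta_0\},\quad \Delta_j'=\min_{G\ni j}\Big(\mu_j-\min_{i\in G}\mu_i\Big),\quad \Delta_j''=\min_{G\ni j}\Delta_G,\quad \Delta_0=\min_{G\neq G^*}\Delta_G$$ (with $\Delta_0=+\infty$ if $G^*$ is the only group). **Algorithm (StableOpt variant with parameters $\varepsilon\in(0,1)$,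 $\delta$, $T$).** Let $T_j(t)$ be the number of pulls of arm $j$ in rounds $1,\dots,t$, let $\hat\mu_{j,k}=\frac1k\sum_{s=1}^kX_{j,s}$, and let $$U(k,\delta)=(1+\sqrt\varepsilon)\sqrt{\frac{1+\varepsilon}{2k}\log\frac{\log((1+\varepsilon)k)}{\delta}} .$$ If $T_j(t)\ge1$, let $\mathrm{UCB}_t(j)=\hat\mu_{j,T_j(t)}+U(T_j(t),\frac{\delta}{n})$ and $\mathrm{LCB}_t(j)=\hat\mu_{j,T_j(t)}-U(T_j(t),\frac{\delta}{n})$; if $T_j(t)=0$, let $\mathrm{UCB}_t(j)=1$ and $\mathrm{LCB}_t(j)=0$. In each round $t=1,\dots,T$ the algorithm picks $G_t\in\arg\max_{G\in\mathcal G}\min_{j\in G}\mathrm{UCB}_{t-1}(j)$ and pulls an arm $j_t\in\arg\min_{j\in G_t}\mathrm{LCB}_{t-1}(j)$. After $T$ rounds it outputs $G^{(T)}=G_{t^*}$ with $t^*\in\arg\max_{1\le t\le T}\min_{j\in G_t}\mathrm{LCB}_{t-1}(j)$. All ties are broken arbitrarily. **Statement.** For every fixed $\varepsilon\in(0,1)$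 there are constants $C,c>0$, depending only on $\varepsilon$, such that the following holds for every instance as above, every $\delta\in\big(0,\frac{\log 2}{e}\big)$ and every $\Delta_{\min}>0$ with $\Delta_j\ge\Delta_{\min}$ for all $j=1,\dots,n$: if $$T\ \ge\ c\,A\,\max\{1,\log\log A\},\qquad A=\frac{n\log\frac n\delta}{\Delta_{\min}^2}$$ (where the maximum is read as $1$ if $A\le e$), then $\mathbb P[G^{(T)}\ne G^*]\le C\delta$; that is, with probability at least $1-C\delta$ the algorithm outputs exactly $G^*$. -/

import Mathlib

open MeasureTheory ProbabilityTheory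
open scoped NNReal

/-- A max-min grouped bandit instance with arms `Fin n`: a finite collection of non-empty, possibly
overlapping groups covering all arms, and a reward distribution for each arm. -/
structure GroupedBandit (n : ℕ) where
  /-- the known set of groups -/
  groups : Finset (Finset (Fin n))
  nonempty_of_mem : ∀ {G : Finset (Fin n)}, G ∈ groups → G.Nonempty
  covers : ∀ j : Fin n, ∃ G ∈ groups, j ∈ G
  /-- the reward distribution of each arm -/
  law : Fin n → Measure ℝ
  isProbabilityMeasure_law : ∀ j, IsProbabilityMeasure (law j)

namespace GroupedBandit

variable {n : ℕ}

/-- The groups of the instance, as a type. -/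
abbrev Group (I : GroupedBandit n) : Type := {G : Finset (Fin n) // G ∈ I.groups}

/-- The mean reward of an arm. -/
noncomputable def mean (I : GroupedBandit n) (j : Fin n) : ℝ := ∫ x, x ∂(I.law j)

/-- `min_{j ∈ G} f j`. -/
noncomputable def groupMin (I : GroupedBandit n) (f : Fin n → ℝ) (G : I.Group) : ℝ :=
  G.1.inf' (I.nonempty_of_mem G.2) f

/-- The mean of the worst arm of a group. -/
noncomputable def worstMean (I : GroupedBandit n) (G : I.Group) : ℝ := I.groupMin I.mean G

/-- Means lie in `[0,1]`, and each reward distribution is sub-Gaussian with parameter `R`: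
`E[exp (s (X - mean))] ≤ exp (s² R² / 2)` for all real `s`. -/
structure BoundedSubGaussian (I : GroupedBandit n) (R : ℝ≥0) : Prop where
  mean_mem : ∀ j, I.mean j ∈ Set.Icc (0 : ℝ) 1
  subGaussian : ∀ j, HasSubgaussianMGF (fun x : ℝ => x - I.mean j) (R ^ 2) (I.law j)

/-- `Gstar` is the unique group with the highest worst arm. -/
def IsUniqueOptimal (I : GroupedBandit n) (Gstar : I.Group) : Prop :=
  ∀ G : I.Group, G ≠ Gstar → I.worstMean G < I.worstMean Gstar

/-! ### Gaps

All minima are over finite sets and are taken in `EReal`, so that a minimum over the empty set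
(which occurs only for `gapZero`, when there is just one group) is `+∞`. -/

/-- The gap `Δ_G` of a group. -/
noncomputable def groupGap (I : GroupedBandit n) (Gstar G : I.Group) : ℝ :=
  I.worstMean Gstar - I.worstMean G

/-- `Δ'_j`: the minimum of `mean j - worstMean G` over the groups `G` containing `j`. -/
noncomputable def gapOne (I : GroupedBandit n) (j : Fin n) : EReal :=
  ⨅ G : {G : I.Group // j ∈ G.1}, ((I.mean j - I.worstMean G.1 : ℝ) : EReal)

/-- `Δ''_j`: the minimum of `Δ_G` over the groups `G` containing `j`. -/
noncomputable def gapTwo (I : GroupedBandit n) (Gstar : I.Group) (j : Fin n) : EReal :=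
  ⨅ G : {G : I.Group // j ∈ G.1}, ((I.groupGap Gstar G.1 : ℝ) : EReal)

/-- `Δ_0`: the minimum of `Δ_G` over the groups `G ≠ Gstar`. -/
noncomputable def gapZero (I : GroupedBandit n) (Gstar : I.Group) : EReal :=
  ⨅ G : {G : I.Group // G ≠ Gstar}, ((I.groupGap Gstar G.1 : ℝ) : EReal)

/-- The overall gap `Δ_j = max {Δ'_j, Δ''_j, Δ_0}` of an arm. -/
noncomputable def gap (I : GroupedBandit n) (Gstar : I.Group) (j : Fin n) : EReal :=
  max (max (I.gapOne j) (I.gapTwo Gstar j)) (I.gapZero Gstar)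

/-! ### Confidence bounds

`x j s` denotes the reward of the `(s+1)`-th pull of arm `j`, and `a t` the arm pulled in round
`t`, where rounds are numbered `1, 2, …`. -/

/-- The number of pulls of arm `j` in rounds `1, …, t`. -/
def pulls (a : ℕ → Fin n) (t : ℕ) (j : Fin n) : ℕ :=
  ((Finset.Icc 1 t).filter (fun s => a s = j)).card

/-- The empirical mean of the first `k` rewards of arm `j`. -/
noncomputable def empMean (x : Fin n → ℕ → ℝ) (j : Fin n) (k : ℕ) : ℝ :=
  (∑ s ∈ Finset.range k, x j s) / (k : ℝ)

/-- The confidence width after `k ≥ 1` pulls,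
`U(k, δ) = (1 + √ε) √((1 + ε)/(2k) · log (log ((1 + ε) k) / δ))`. -/
noncomputable def confWidth (ε : ℝ) (k : ℕ) (δ : ℝ) : ℝ :=
  (1 + √ε) * √((1 + ε) / (2 * (k : ℝ)) * Real.log (Real.log ((1 + ε) * (k : ℝ)) / δ))

/-- `UCB_t(j)`, equal to `1` as long as arm `j` has not been pulled. -/
noncomputable def ucb (ε δ : ℝ) (x : Fin n → ℕ → ℝ) (a : ℕ → Fin n) (t : ℕ) (j : Fin n) : ℝ :=
  if pulls a t j = 0 then 1
  else empMean x j (pulls a t j) + confWidth ε (pulls a t j) (δ / (n : ℝ))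

/-- `LCB_t(j)`, equal to `0` as long as arm `j` has not been pulled. -/
noncomputable def lcb (ε δ : ℝ) (x : Fin n → ℕ → ℝ) (a : ℕ → Fin n) (t : ℕ) (j : Fin n) : ℝ :=
  if pulls a t j = 0 then 0
  else empMean x j (pulls a t j) - confWidth ε (pulls a t j) (δ / (n : ℝ))

/-! ### The algorithm -/

/-- On the reward table `x`, the groups `g t` and arms `a t`, `t = 1, …, T`, are chosen by
the StableOpt rule `g t ∈ argmax_G min_{j ∈ G} UCB_{t-1}(j)` and
`a t ∈ argmin_{j ∈ g t} LCB_{t-1}(j)`, with ties broken in any way. -/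
structure IsStableOptRun (I : GroupedBandit n) (ε δ : ℝ) (x : Fin n → ℕ → ℝ) (T : ℕ)
    (g : ℕ → I.Group) (a : ℕ → Fin n) : Prop where
  group_argmax : ∀ t ∈ Finset.Icc 1 T, ∀ H : I.Group,
    I.groupMin (ucb ε δ x a (t - 1)) H ≤ I.groupMin (ucb ε δ x a (t - 1)) (g t)
  arm_mem : ∀ t ∈ Finset.Icc 1 T, a t ∈ (g t).1
  arm_argmin : ∀ t ∈ Finset.Icc 1 T, ∀ j ∈ (g t).1,
    lcb ε δ x a (t - 1) (a t) ≤ lcb ε δ x a (t - 1) j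

/-- `G` is a possible output of StableOpt after `T` rounds on the reward table `x` (there may be
several, according to how ties are broken): `G = g t*` for a run `(g, a)`, where
`t* ∈ argmax_{1 ≤ t ≤ T} min_{j ∈ g t} LCB_{t-1}(j)`. -/
def IsStableOptOutput (I : GroupedBandit n) (ε δ : ℝ) (x : Fin n → ℕ → ℝ) (T : ℕ)
    (G : I.Group) : Prop :=
  ∃ (g : ℕ → I.Group) (a : ℕ → Fin n), I.IsStableOptRun ε δ x T g a ∧
    ∃ tstar ∈ Finset.Icc 1 T,
      (∀ t ∈ Finset.Icc 1 T, I.groupMin (lcb ε δ x a (t - 1)) (g t) ≤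
        I.groupMin (lcb ε δ x a (tstar - 1)) (g tstar)) ∧
      G = g tstar

/-- `X j s`, `s = 0, 1, …`, are the successive rewards of arm `j`: for each arm, independent draws
from its reward distribution. -/
structure IsRewardTable (I : GroupedBandit n) {Ω : Type*} [MeasurableSpace Ω] (P : Measure Ω)
    (X : Fin n → ℕ → Ω → ℝ) : Prop where
  hasLaw : ∀ j s, HasLaw (X j s) (I.law j) P
  indep : ∀ j, iIndepFun (X j) P

end GroupedBandit

/-- `A · max (1, log log A)`, written so that the factor is `1` for `0 < A ≤ exp (exp 1)`. -/
noncomputable def mulLogLog (A : ℝ) : ℝ :=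
  A * Real.log (max (Real.exp 1) (Real.log A))

/-!
By independence, `exp (l * S k)` is a submartingale for the centred reward sums `S k` of an arm, so
Doob's maximal inequality bounds the probability that `S` crosses a fixed level at some time of a
block `(1 + √ε) ^ (2 * i) ≤ k < (1 + √ε) ^ (2 * i + 2)` by `O((i + 1) ^ (-(1 + ε)))` times the
desired failure probability. These bounds are summable over the blocks, whence all confidence
intervals contain the means at all times, up to probability `O(δ)`.

On this event, by pigeonhole, some round `t` pulls an arm that has already been pulled at least
`T / n - 1` times, so that its confidence interval is shorter than `Δmin`. As this arm has the
lowest LCB of its group and a UCB above the best worst mean, a short interval is compatible only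
with a gap `Δ_j` attained by `Δ₀`, and then the group's smallest LCB exceeds the worst mean of every
suboptimal group. The output has an at least as large smallest LCB, hence is not suboptimal.
-/

section MaximalInequality

variable {Ω : Type*} [mΩ : MeasurableSpace Ω] {P : Measure Ω}

lemma measureReal_iUnion_le_tsum [IsFiniteMeasure P] {s : ℕ → Set Ω} {b : ℕ → ℝ}
    (hb : Summable b) (hs : ∀ i, P.real (s i) ≤ b i) : P.real (⋃ i, s i) ≤ ∑' i, b i := by
  have hb0 : ∀ i, 0 ≤ b i := fun i => measureReal_nonneg.trans (hs i)
  refine ENNReal.toReal_le_of_le_ofReal (tsum_nonneg hb0) ?_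
  rw [ENNReal.ofReal_tsum_of_nonneg hb0 hb]
  exact (measure_iUnion_le s).trans (ENNReal.tsum_le_tsum fun i =>
    (ENNReal.le_ofReal_iff_toReal_le (measure_ne_top P _) (hb0 i)).mpr (hs i))

lemma measureReal_exists_le_submartingale_le [IsFiniteMeasure P] {𝒢 : Filtration ℕ mΩ}
    {f : ℕ → Ω → ℝ} (hf : Submartingale f 𝒢 P) (hnonneg : 0 ≤ f) {a : ℝ} (ha : 0 < a) (m : ℕ) :
    P.real {ω | ∃ k ≤ m, a ≤ f k ω} ≤ (∫ ω, f m ω ∂P) / a := by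
  lift a to ℝ≥0 using ha.le
  have hset : {ω | ∃ k ≤ m, a ≤ f k ω} =
      {ω | a ≤ (Finset.range (m + 1)).sup' Finset.nonempty_range_add_one fun k => f k ω} := by
    ext ω
    simp only [Set.mem_ofPred_eq, Finset.le_sup'_iff, Finset.mem_range, Nat.lt_succ_iff]
  have hdoob := maximal_ineq hf hnonneg (ε := a) m
  rw [← hset] at hdoob
  have hdoob_real := ENNReal.toReal_mono ENNReal.ofReal_ne_top hdoob
  rw [ENNReal.toReal_mul, ENNReal.toReal_ofReal (integral_nonneg (hnonneg m))] at hdoob_real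
  rw [le_div_iff₀' ha]
  exact hdoob_real.trans
    (setIntegral_le_integral (hf.integrable m) (ae_of_all _ (hnonneg m)))

variable [IsProbabilityMeasure P]

lemma one_le_mgf_of_integral_eq_zero {Y : Ω → ℝ} (hY : Integrable Y P)
    (hmean : ∫ ω, Y ω ∂P = 0) {l : ℝ} (hexp : Integrable (fun ω => Real.exp (l * Y ω)) P) :
    1 ≤ mgf Y P l :=
  calc (1 : ℝ) = ∫ ω, (l * Y ω + 1) ∂P := by
        rw [integral_add (hY.const_mul l) (integrable_const _), integral_const_mul, hmean,
          mul_zero, zero_add, integral_const, probReal_univ, one_smul]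
    _ ≤ mgf Y P l := integral_mono ((hY.const_mul l).add (integrable_const _)) hexp
        fun _ => Real.add_one_le_exp _

lemma integral_eq_zero_of_hasSubgaussianMGF {Y : Ω → ℝ} {c : ℝ≥0}
    (hY : HasSubgaussianMGF Y c P) : ∫ ω, Y ω ∂P = 0 := by
  have hmgf : HasDerivAt (mgf Y P) (∫ ω, Y ω ∂P) 0 := by
    simpa using hasDerivAt_mgf (X := Y) (μ := P) (t := 0) (by simp [hY.integrableExpSet_eq_univ])
  have hbound : HasDerivAt (fun t : ℝ => Real.exp (c * t ^ 2 / 2)) 0 0 := by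
    simpa using ((((hasDerivAt_id (0 : ℝ)).pow 2).const_mul (c : ℝ)).div_const 2).exp
  -- `exp (c t² / 2) - mgf t` is nonnegative and vanishes at `0`, which is therefore critical.
  have hmin : IsLocalMin (fun t : ℝ => Real.exp (c * t ^ 2 / 2) - mgf Y P t) 0 :=
    Filter.Eventually.of_forall fun t => by simpa using hY.mgf_le t
  linarith [hmin.hasDerivAt_eq_zero (hbound.sub hmgf)]

lemma submartingale_exp_mul_sum_range {Y : ℕ → Ω → ℝ} (hindep : iIndepFun Y P)
    (hmeas : ∀ i, Measurable (Y i)) (hint : ∀ i, Integrable (Y i) P)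
    (hmean : ∀ i, ∫ ω, Y i ω ∂P = 0) {l : ℝ}
    (hexp : ∀ i, Integrable (fun ω => Real.exp (l * Y i ω)) P) :
    Submartingale (fun k ω => Real.exp (l * (∑ i ∈ Finset.range (k + 1), Y i) ω))
      (Filtration.natural Y fun i => (hmeas i).stronglyMeasurable) P := by
  set ℱ := Filtration.natural Y fun i => (hmeas i).stronglyMeasurable
  set M : ℕ → Ω → ℝ := fun k ω => Real.exp (l * (∑ i ∈ Finset.range (k + 1), Y i) ω)
  have hadapted : StronglyAdapted ℱ M := fun k =>
    Real.continuous_exp.comp_stronglyMeasurable <| StronglyMeasurable.const_mul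
      (Finset.stronglyMeasurable_sum _ fun i hi =>
        (Filtration.stronglyAdapted_natural (fun i => (hmeas i).stronglyMeasurable) i).mono
          (ℱ.mono (Nat.lt_succ_iff.mp (Finset.mem_range.mp hi)))) l
  have hM : ∀ k, Integrable (M k) P := fun k =>
    hindep.integrable_exp_mul_sum hmeas fun i _ => hexp i
  refine submartingale_nat hadapted hM fun k => ?_
  have hsucc : M (k + 1) = M k * fun ω => Real.exp (l * Y (k + 1) ω) := by
    funext ω
    simp only [M, Finset.sum_range_succ _ (k + 1), Pi.mul_apply, ← Real.exp_add, Pi.add_apply,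
      mul_add]
  have hpull := condExp_mul_of_stronglyMeasurable_left (μ := P) (hadapted k)
    (hsucc ▸ hM (k + 1)) (hexp (k + 1))
  have hfresh := condExp_indep_eq (μ := P) (hmeas (k + 1)).comap_le (ℱ.le k)
    (f := fun ω => Real.exp (l * Y (k + 1) ω))
    (Real.continuous_exp.comp_stronglyMeasurable
      ((comap_measurable (Y (k + 1))).stronglyMeasurable.const_mul l))
    (hindep.indep_comap_natural_of_lt _ (Nat.lt_succ_self k))
  rw [hsucc]
  filter_upwards [hpull, hfresh] with ω hpull hfresh
  rw [hpull, Pi.mul_apply, hfresh]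
  exact le_mul_of_one_le_right (Real.exp_pos _).le
    (one_le_mgf_of_integral_eq_zero (hint _) (hmean _) (hexp _))

lemma measureReal_exists_le_sum_range_le_exp_mul_mgf {Y : ℕ → Ω → ℝ} (hindep : iIndepFun Y P)
    (hmeas : ∀ i, Measurable (Y i)) (hint : ∀ i, Integrable (Y i) P)
    (hmean : ∀ i, ∫ ω, Y i ω ∂P = 0) {l : ℝ} (hl : 0 ≤ l)
    (hexp : ∀ i, Integrable (fun ω => Real.exp (l * Y i ω)) P) (x : ℝ) (m : ℕ) :
    P.real {ω | ∃ k ≤ m, x ≤ ∑ i ∈ Finset.range (k + 1), Y i ω} ≤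
      Real.exp (-(l * x)) * mgf (∑ i ∈ Finset.range (m + 1), Y i) P l := by
  have hsub := submartingale_exp_mul_sum_range hindep hmeas hint hmean hexp
  have hdoob := measureReal_exists_le_submartingale_le hsub
    (fun _ _ => (Real.exp_pos _).le) (Real.exp_pos (l * x)) m
  rw [div_eq_inv_mul, ← Real.exp_neg] at hdoob
  refine (measureReal_mono ?_).trans hdoob
  rintro ω ⟨k, hk, hx⟩
  refine ⟨k, hk, Real.exp_le_exp.mpr (mul_le_mul_of_nonneg_left ?_ hl)⟩
  rwa [Finset.sum_apply]

lemma measureReal_exists_le_sum_range_le {Y : ℕ → Ω → ℝ} (hindep : iIndepFun Y P) {c : ℝ≥0}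
    (hsub : ∀ i, HasSubgaussianMGF (Y i) c P) {x : ℝ} (hx : 0 ≤ x) (m : ℕ) :
    P.real {ω | ∃ k ∈ Finset.Icc 1 m, x ≤ ∑ i ∈ Finset.range k, Y i ω} ≤
      Real.exp (-x ^ 2 / (2 * m * c)) := by
  wlog hmeas : ∀ i, Measurable (Y i) generalizing Y
  · have hmk := fun i => (hsub i).aemeasurable.ae_eq_mk
    refine le_of_eq_of_le (measureReal_congr (Filter.eventuallyEq_set.mpr ?_))
      (this (hindep.congr hmk)
      (fun i => (hsub i).congr (hmk i)) fun i => (hsub i).aemeasurable.measurable_mk)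
    filter_upwards [ae_all_iff.mpr hmk] with ω hω
    simp only [hω]
  obtain rfl | hc := eq_zero_or_pos c
  · simp
  obtain _ | m := m
  · simp
  set M : ℝ := ((m + 1 : ℕ) : ℝ)
  -- `l = x / (M c)` minimizes the Chernoff exponent `M c l² / 2 - l x`.
  set l : ℝ := x / (M * c) with hl
  have hmgf : mgf (∑ i ∈ Finset.range (m + 1), Y i) P l ≤ Real.exp (M * c * l ^ 2 / 2) := by
    have h := (HasSubgaussianMGF.sum_of_iIndepFun hindep (c := fun _ => c)
      (s := Finset.range (m + 1)) fun i _ => hsub i).mgf_le l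
    simpa [M, ← Finset.sum_apply] using h
  calc P.real {ω | ∃ k ∈ Finset.Icc 1 (m + 1), x ≤ ∑ i ∈ Finset.range k, Y i ω}
      ≤ P.real {ω | ∃ k ≤ m, x ≤ ∑ i ∈ Finset.range (k + 1), Y i ω} := by
        refine measureReal_mono ?_
        rintro ω ⟨k, hk, hxk⟩
        obtain ⟨hk1, hkm⟩ := Finset.mem_Icc.mp hk
        exact ⟨k - 1, by omega, by rwa [Nat.sub_add_cancel hk1]⟩
    _ ≤ Real.exp (-(l * x)) * mgf (∑ i ∈ Finset.range (m + 1), Y i) P l :=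
        measureReal_exists_le_sum_range_le_exp_mul_mgf hindep hmeas (fun i => (hsub i).integrable)
          (fun i => integral_eq_zero_of_hasSubgaussianMGF (hsub i)) (by positivity)
          (fun i => (hsub i).integrable_exp_mul l) x m
    _ ≤ Real.exp (-(l * x)) * Real.exp (M * c * l ^ 2 / 2) := by gcongr
    _ = Real.exp (-x ^ 2 / (2 * M * c)) := by
        rw [← Real.exp_add, hl]
        congr 1
        field_simp
        ring

end MaximalInequality

namespace GroupedBandit

section ConfidenceSequence

/-- The factor `ζ(1 + ε) / log (1 + ε)` by which the failure probability of the one-sided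
confidence bounds `confWidth ε · d` may exceed `d`. -/
noncomputable def failureFactor (ε : ℝ) : ℝ :=
  (∑' i : ℕ, 1 / ((i : ℝ) + 1) ^ (1 + ε)) / Real.log (1 + ε)

/-- The level that a partial sum must reach to cross the boundary `k * confWidth ε k d` at some
time `k` of the `i`-th block `(1 + √ε)^(2i) ≤ k < (1 + √ε)^(2i+2)`. -/
noncomputable def blockLevel (ε d : ℝ) (i : ℕ) : ℝ :=
  (1 + √ε) * √((1 + ε) / 2 * ((1 + √ε) ^ 2) ^ i * Real.log ((i + 1) * Real.log (1 + ε) / d))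

variable {ε d : ℝ}

lemma summable_one_div_add_one_rpow {s : ℝ} (hs : 1 < s) :
    Summable fun i : ℕ => 1 / ((i : ℝ) + 1) ^ s := by
  simpa using (summable_nat_add_iff 1).mpr (Real.summable_one_div_nat_rpow.mpr hs)

lemma one_le_tsum_one_div_add_one_rpow {s : ℝ} (hs : 1 < s) :
    1 ≤ ∑' i : ℕ, 1 / ((i : ℝ) + 1) ^ s := by
  simpa using (summable_one_div_add_one_rpow hs).le_tsum 0 fun i _ => by positivity

lemma log_one_add_pos (hε : 0 < ε) : 0 < Real.log (1 + ε) := Real.log_pos (by linarith)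

lemma failureFactor_pos (hε : 0 < ε) : 0 < failureFactor ε :=
  div_pos (one_pos.trans_le (one_le_tsum_one_div_add_one_rpow (by linarith))) (log_one_add_pos hε)

lemma one_le_failureFactor_mul (hε : 0 < ε) (hd : Real.log (1 + ε) ≤ d) :
    1 ≤ failureFactor ε * d := by
  have hlog := log_one_add_pos hε
  rw [failureFactor, div_mul_eq_mul_div, one_le_div hlog]
  exact hd.trans (le_mul_of_one_le_left (hlog.le.trans hd)
    (one_le_tsum_one_div_add_one_rpow (by linarith)))

lemma one_le_add_one_mul_log_div (hd : 0 < d) (hdε : d ≤ Real.log (1 + ε)) (i : ℕ) :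
    1 ≤ ((i : ℝ) + 1) * Real.log (1 + ε) / d := by
  rw [one_le_div hd]
  exact hdε.trans (le_mul_of_one_le_left (hd.le.trans hdε) (by simp))

lemma add_one_mul_log_le_log (hε : 0 < ε) {k i : ℕ} (hi : ((1 + √ε) ^ 2) ^ i ≤ (k : ℝ)) :
    ((i : ℝ) + 1) * Real.log (1 + ε) ≤ Real.log ((1 + ε) * k) := by
  have hratio : 1 + ε ≤ (1 + √ε) ^ 2 := by
    nlinarith [Real.sq_sqrt hε.le, Real.sqrt_nonneg ε]
  calc ((i : ℝ) + 1) * Real.log (1 + ε) = Real.log ((1 + ε) ^ (i + 1)) := by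
        rw [Real.log_pow, Nat.cast_add_one]
    _ ≤ Real.log ((1 + ε) * k) := by
        refine Real.log_le_log (by positivity) ?_
        rw [pow_succ']
        have := (pow_le_pow_left₀ (by positivity) hratio i).trans hi
        gcongr

lemma mul_confWidth (ε d : ℝ) {k : ℕ} (hk : 1 ≤ k) :
    k * confWidth ε k d =
      (1 + √ε) * √((1 + ε) / 2 * k * Real.log (Real.log ((1 + ε) * k) / d)) := by
  have hk0 : (0 : ℝ) < k := by exact_mod_cast hk
  rw [confWidth, mul_left_comm]
  nth_rewrite 1 [← Real.sqrt_sq hk0.le]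
  rw [← Real.sqrt_mul (sq_nonneg _)]
  congr 2
  field_simp

lemma blockLevel_le_mul_confWidth (hε : 0 < ε) (hd : 0 < d) (hdε : d ≤ Real.log (1 + ε))
    {k i : ℕ} (hk : 1 ≤ k) (hi : ((1 + √ε) ^ 2) ^ i ≤ (k : ℝ)) :
    blockLevel ε d i ≤ k * confWidth ε k d := by
  have hratio := one_le_add_one_mul_log_div hd hdε i
  have hlog_nonneg := Real.log_nonneg hratio
  have hlog_le : Real.log (((i : ℝ) + 1) * Real.log (1 + ε) / d) ≤
      Real.log (Real.log ((1 + ε) * k) / d) :=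
    Real.log_le_log (by linarith) (by gcongr; exact add_one_mul_log_le_log hε hi)
  rw [mul_confWidth ε d hk, blockLevel]
  gcongr

lemma exp_neg_blockLevel_sq_le (hε : 0 < ε) (hd : 0 < d) (hdε : d ≤ Real.log (1 + ε)) {i m : ℕ}
    (hm : 1 ≤ m) (hmi : (m : ℝ) ≤ ((1 + √ε) ^ 2) ^ (i + 1)) :
    Real.exp (-blockLevel ε d i ^ 2 / (2 * m * (1 / 4))) ≤
      d / Real.log (1 + ε) * (1 / ((i : ℝ) + 1) ^ (1 + ε)) := by
  have hratio := one_le_add_one_mul_log_div hd hdε i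
  have hlogε := log_one_add_pos hε
  have : (0 : ℝ) < m := by exact_mod_cast hm
  set ρ := ((i : ℝ) + 1) * Real.log (1 + ε) / d with hρ
  have hlog : 0 ≤ Real.log ρ := Real.log_nonneg hratio
  have hexponent : (1 + ε) * Real.log ρ ≤ blockLevel ε d i ^ 2 / (2 * m * (1 / 4)) := by
    rw [le_div_iff₀ (by positivity), blockLevel, mul_pow, Real.sq_sqrt (by positivity)]
    calc (1 + ε) * Real.log ρ * (2 * m * (1 / 4)) = m * ((1 + ε) / 2 * Real.log ρ) := by ring
      _ ≤ ((1 + √ε) ^ 2) ^ (i + 1) * ((1 + ε) / 2 * Real.log ρ) := by gcongr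
      _ = _ := by ring
  calc Real.exp (-blockLevel ε d i ^ 2 / (2 * m * (1 / 4)))
      ≤ Real.exp (Real.log ρ * -(1 + ε)) := by
        rw [neg_div]
        exact Real.exp_le_exp.mpr (by linarith)
    _ = (((i : ℝ) + 1) ^ (1 + ε) * (Real.log (1 + ε) / d) ^ (1 + ε))⁻¹ := by
        rw [← Real.rpow_def_of_pos (by linarith), Real.rpow_neg (by linarith), hρ, mul_div_assoc,
          Real.mul_rpow (by positivity) (by positivity)]
    _ ≤ (((i : ℝ) + 1) ^ (1 + ε) * (Real.log (1 + ε) / d))⁻¹ := by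
        gcongr
        exact Real.self_le_rpow_of_one_le ((one_le_div hd).mpr hdε) (by linarith)
    _ = d / Real.log (1 + ε) * (1 / ((i : ℝ) + 1) ^ (1 + ε)) := by
        rw [mul_inv, inv_div, one_div, mul_comm]

variable {Ω : Type*} [MeasurableSpace Ω] {P : Measure Ω} [IsProbabilityMeasure P]

lemma measureReal_exists_mul_confWidth_le_sum (hε : 0 < ε) (hd : 0 < d) {Y : ℕ → Ω → ℝ}
    (hindep : iIndepFun Y P) (hsub : ∀ i, HasSubgaussianMGF (Y i) (1 / 4) P) :
    P.real {ω | ∃ k : ℕ, 1 ≤ k ∧ k * confWidth ε k d ≤ ∑ s ∈ Finset.range k, Y s ω} ≤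
      failureFactor ε * d := by
  obtain hdε | hdε := le_total (Real.log (1 + ε)) d
  · exact measureReal_le_one.trans (one_le_failureFactor_mul hε hdε)
  set q := (1 + √ε) ^ 2
  have hq : 1 < q := one_lt_pow₀ (by linarith [Real.sqrt_pos.mpr hε]) two_ne_zero
  set crossing : ℕ → Set Ω := fun i => {ω | ∃ k ∈ Finset.Icc 1 ⌊q ^ (i + 1)⌋₊,
    blockLevel ε d i ≤ ∑ s ∈ Finset.range k, Y s ω}
  have hcrossing : ∀ i, P.real (crossing i) ≤
      d / Real.log (1 + ε) * (1 / ((i : ℝ) + 1) ^ (1 + ε)) := fun i =>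
    (measureReal_exists_le_sum_range_le hindep hsub (by unfold blockLevel; positivity) _).trans
      (exp_neg_blockLevel_sq_le hε hd hdε (Nat.le_floor (by exact_mod_cast one_le_pow₀ hq.le))
        (Nat.floor_le (by positivity)))
  have hcover : {ω | ∃ k : ℕ, 1 ≤ k ∧ k * confWidth ε k d ≤ ∑ s ∈ Finset.range k, Y s ω} ⊆
      ⋃ i, crossing i := by
    rintro ω ⟨k, hk, hkω⟩
    obtain ⟨i, hi, hi'⟩ := exists_nat_pow_near (x := (k : ℝ)) (by exact_mod_cast hk) hq
    exact Set.mem_iUnion.mpr ⟨i, k, Finset.mem_Icc.mpr ⟨hk, Nat.le_floor hi'.le⟩,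
      (blockLevel_le_mul_confWidth hε hd hdε hk hi).trans hkω⟩
  calc P.real {ω | ∃ k : ℕ, 1 ≤ k ∧ k * confWidth ε k d ≤ ∑ s ∈ Finset.range k, Y s ω}
      ≤ P.real (⋃ i, crossing i) := measureReal_mono hcover
    _ ≤ ∑' i : ℕ, d / Real.log (1 + ε) * (1 / ((i : ℝ) + 1) ^ (1 + ε)) :=
        measureReal_iUnion_le_tsum
          ((summable_one_div_add_one_rpow (by linarith)).mul_left _) hcrossing
    _ = failureFactor ε * d := by
        rw [tsum_mul_left, failureFactor]
        ring

lemma measureReal_exists_mul_confWidth_lt_abs_sum (hε : 0 < ε) (hd : 0 < d) {Y : ℕ → Ω → ℝ}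
    (hindep : iIndepFun Y P) (hsub : ∀ i, HasSubgaussianMGF (Y i) (1 / 4) P) :
    P.real {ω | ∃ k : ℕ, 1 ≤ k ∧ k * confWidth ε k d < |∑ s ∈ Finset.range k, Y s ω|} ≤
      2 * failureFactor ε * d := by
  have hupper := measureReal_exists_mul_confWidth_le_sum hε hd hindep hsub
  have hlower := measureReal_exists_mul_confWidth_le_sum hε hd
    (hindep.comp (fun _ y => -y) fun _ => measurable_neg) fun i => (hsub i).neg
  refine (measureReal_mono ?_).trans ((measureReal_union_le _ _).trans
    ((add_le_add hupper hlower).trans_eq (by ring)))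
  rintro ω ⟨k, hk, hkω⟩
  refine (lt_abs.mp hkω).imp (fun h => ⟨k, hk, h.le⟩) fun h => ⟨k, hk, ?_⟩
  simpa only [Function.comp_apply, Finset.sum_neg_distrib] using h.le

end ConfidenceSequence

section ConfidenceIntervals

variable {n : ℕ} {I : GroupedBandit n} {ε δ : ℝ}

/-- The event, in terms of the reward table `x`, that at every positive number of pulls the
confidence interval of each arm contains its mean. -/
def ConfidenceIntervalsHold (I : GroupedBandit n) (ε δ : ℝ) (x : Fin n → ℕ → ℝ) : Prop :=
  ∀ (j : Fin n) (k : ℕ), 1 ≤ k → |empMean x j k - I.mean j| ≤ confWidth ε k (δ / n)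

lemma mul_empMean_sub (x : Fin n → ℕ → ℝ) (j : Fin n) {k : ℕ} (hk : 1 ≤ k) (m : ℝ) :
    k * (empMean x j k - m) = ∑ s ∈ Finset.range k, (x j s - m) := by
  have hk0 : (k : ℝ) ≠ 0 := by positivity
  rw [empMean, Finset.sum_sub_distrib, Finset.sum_const, Finset.card_range, nsmul_eq_mul, mul_sub,
    mul_div_cancel₀ _ hk0]

variable {Ω : Type*} [MeasurableSpace Ω] {P : Measure Ω} {X : Fin n → ℕ → Ω → ℝ}

lemma IsRewardTable.hasSubgaussianMGF_sub_mean (hX : I.IsRewardTable P X) {R : ℝ≥0}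
    (hI : I.BoundedSubGaussian R) (j : Fin n) (s : ℕ) :
    HasSubgaussianMGF (fun ω => X j s ω - I.mean j) (R ^ 2) P :=
  HasSubgaussianMGF.of_map (Y := X j s) (X := fun x => x - I.mean j) (hX.hasLaw j s).aemeasurable
    ((hX.hasLaw j s).map_eq ▸ hI.subGaussian j)

lemma hasSubgaussianMGF_mono {Y : Ω → ℝ} {c c' : ℝ≥0} (hY : HasSubgaussianMGF Y c P)
    (hc : c ≤ c') : HasSubgaussianMGF Y c' P :=
  ⟨hY.integrable_exp_mul, fun t => (hY.mgf_le t).trans (Real.exp_le_exp.mpr (by gcongr))⟩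

lemma measureReal_not_confidenceIntervalsHold_le [IsProbabilityMeasure P] {R : ℝ≥0}
    (hR : R ≤ 1 / 2) (hI : I.BoundedSubGaussian R) (hε : 0 < ε) (hδ : 0 < δ)
    (hX : I.IsRewardTable P X) :
    P.real {ω | ¬ I.ConfidenceIntervalsHold ε δ fun j s => X j s ω} ≤
      2 * failureFactor ε * δ := by
  have hR2 : R ^ 2 ≤ 1 / 4 := (pow_le_pow_left₀ zero_le hR 2).trans_eq (by norm_num)
  set miss : Fin n → Set Ω := fun j => {ω | ∃ k : ℕ, 1 ≤ k ∧
    k * confWidth ε k (δ / n) < |∑ s ∈ Finset.range k, (X j s ω - I.mean j)|}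
  have hmiss : ∀ j, P.real (miss j) ≤ 2 * failureFactor ε * (δ / n) := fun j =>
    have hn : (0 : ℝ) < n := by exact_mod_cast j.pos
    measureReal_exists_mul_confWidth_lt_abs_sum hε (div_pos hδ hn)
      ((hX.indep j).comp (fun _ x => x - I.mean j) fun _ => measurable_id.sub_const _)
      fun s => hasSubgaussianMGF_mono (hX.hasSubgaussianMGF_sub_mean hI j s) hR2
  have hcover : {ω | ¬ I.ConfidenceIntervalsHold ε δ fun j s => X j s ω} ⊆ ⋃ j, miss j := by
    intro ω hω
    simp only [Set.mem_ofPred_eq, ConfidenceIntervalsHold, not_forall, not_le] at hω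
    obtain ⟨j, k, hk, hkω⟩ := hω
    refine Set.mem_iUnion.mpr ⟨j, k, hk, ?_⟩
    have hk0 : (0 : ℝ) < k := by exact_mod_cast hk
    rw [← mul_empMean_sub (fun j s => X j s ω) j hk, abs_mul, abs_of_pos hk0]
    exact mul_lt_mul_of_pos_left hkω hk0
  calc P.real {ω | ¬ I.ConfidenceIntervalsHold ε δ fun j s => X j s ω}
      ≤ P.real (⋃ j, miss j) := measureReal_mono hcover
    _ ≤ ∑ j, P.real (miss j) := measureReal_iUnion_fintype_le _
    _ ≤ ∑ _j : Fin n, 2 * failureFactor ε * (δ / n) := Finset.sum_le_sum fun j _ => hmiss j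
    _ = 2 * failureFactor ε * (n * (δ / n)) := by
        rw [Finset.sum_const, Finset.card_univ, Fintype.card_fin, nsmul_eq_mul]
        ring
    _ ≤ 2 * failureFactor ε * δ := by
        have hδn : n * (δ / n) ≤ δ := by
          obtain hn | hn := eq_or_ne (n : ℝ) 0
          · simpa only [hn, zero_mul] using hδ.le
          · exact (mul_div_cancel₀ δ hn).le
        have := (failureFactor_pos hε).le
        gcongr

end ConfidenceIntervals

section Pulls

variable {n : ℕ}

lemma pulls_succ (a : ℕ → Fin n) (t : ℕ) (j : Fin n) :
    pulls a (t + 1) j = pulls a t j + if a (t + 1) = j then 1 else 0 := by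
  rw [pulls, pulls, ← Finset.insert_Icc_right_eq_Icc_add_one (by omega), Finset.filter_insert]
  split_ifs
  · rw [Finset.card_insert_of_notMem (by simp)]
  · rfl

lemma sum_pulls (a : ℕ → Fin n) (T : ℕ) : ∑ j, pulls a T j = T := by
  have hfiber := Finset.card_eq_sum_card_fiberwise (s := Finset.Icc 1 T) (t := Finset.univ) (f := a)
    fun _ _ => Finset.mem_coe.mpr (Finset.mem_univ _)
  rw [Nat.card_Icc, Nat.add_sub_cancel] at hfiber
  exact hfiber.symm

lemma exists_pulls_eq_add_one {a : ℕ → Fin n} {T : ℕ} {j : Fin n} (h : 0 < pulls a T j) :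
    ∃ t ∈ Finset.Icc 1 T, a t = j ∧ pulls a T j = pulls a (t - 1) j + 1 := by
  induction T with
  | zero => simp [pulls] at h
  | succ T ih =>
    by_cases hj : a (T + 1) = j
    · exact ⟨T + 1, by simp, hj, by rw [pulls_succ, if_pos hj, Nat.add_sub_cancel]⟩
    · rw [pulls_succ, if_neg hj, add_zero] at h ⊢
      obtain ⟨t, ht, hlast⟩ := ih h
      exact ⟨t, Finset.Icc_subset_Icc_right (Nat.le_succ T) ht, hlast⟩

lemma exists_round_le_mul_pulls_add_one (a : ℕ → Fin n) {T : ℕ} (hT : 1 ≤ T) :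
    ∃ t ∈ Finset.Icc 1 T, T ≤ n * (pulls a (t - 1) (a t) + 1) := by
  have hn : (Finset.univ : Finset (Fin n)).Nonempty := ⟨a 0, Finset.mem_univ _⟩
  obtain ⟨j, -, hj⟩ := Finset.exists_max_image Finset.univ (pulls a T) hn
  have hle : T ≤ n * pulls a T j := by
    conv_lhs => rw [← sum_pulls a T]
    refine (Finset.sum_le_card_nsmul _ _ _ hj).trans_eq ?_
    rw [Finset.card_univ, Fintype.card_fin, smul_eq_mul]
  have hpos : 0 < pulls a T j := pos_of_mul_pos_right (hT.trans hle) n.zero_le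
  obtain ⟨t, ht, rfl, hlast⟩ := exists_pulls_eq_add_one hpos
  exact ⟨t, ht, hlast ▸ hle⟩

end Pulls

section Gaps

variable {n : ℕ} {I : GroupedBandit n}

lemma groupMin_le (f : Fin n → ℝ) {G : I.Group} {j : Fin n} (hj : j ∈ G.1) :
    I.groupMin f G ≤ f j :=
  Finset.inf'_le f hj

lemma le_groupMin {f : Fin n → ℝ} {G : I.Group} {b : ℝ} (h : ∀ j ∈ G.1, b ≤ f j) :
    b ≤ I.groupMin f G :=
  Finset.le_inf' _ _ h

lemma groupMin_mono {f f' : Fin n → ℝ} (h : ∀ j, f j ≤ f' j) (G : I.Group) :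
    I.groupMin f G ≤ I.groupMin f' G :=
  le_groupMin fun j hj => (groupMin_le f hj).trans (h j)

lemma worstMean_mem_Icc (h : ∀ j, I.mean j ∈ Set.Icc (0 : ℝ) 1) (G : I.Group) :
    I.worstMean G ∈ Set.Icc (0 : ℝ) 1 := by
  obtain ⟨j, hj⟩ := I.nonempty_of_mem G.2
  exact ⟨le_groupMin fun j _ => (h j).1, (groupMin_le _ hj).trans (h j).2⟩

lemma le_gapOne_iff {d : ℝ} {j : Fin n} :
    (d : EReal) ≤ I.gapOne j ↔ ∀ G : I.Group, j ∈ G.1 → d ≤ I.mean j - I.worstMean G := by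
  simp only [gapOne, le_iInf_iff, EReal.coe_le_coe_iff, Subtype.forall]

lemma le_gapTwo_iff {d : ℝ} {Gstar : I.Group} {j : Fin n} :
    (d : EReal) ≤ I.gapTwo Gstar j ↔
      ∀ G : I.Group, j ∈ G.1 → d ≤ I.worstMean Gstar - I.worstMean G := by
  simp only [gapTwo, groupGap, le_iInf_iff, EReal.coe_le_coe_iff, Subtype.forall]

lemma le_gapZero_iff {d : ℝ} {Gstar : I.Group} :
    (d : EReal) ≤ I.gapZero Gstar ↔
      ∀ G : I.Group, G ≠ Gstar → d ≤ I.worstMean Gstar - I.worstMean G := by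
  simp only [gapZero, groupGap, le_iInf_iff, EReal.coe_le_coe_iff, Subtype.forall]

lemma le_gap_iff {d : ℝ} {Gstar : I.Group} {j : Fin n} :
    (d : EReal) ≤ I.gap Gstar j ↔
      (∀ G : I.Group, j ∈ G.1 → d ≤ I.mean j - I.worstMean G) ∨
      (∀ G : I.Group, j ∈ G.1 → d ≤ I.worstMean Gstar - I.worstMean G) ∨
      (∀ G : I.Group, G ≠ Gstar → d ≤ I.worstMean Gstar - I.worstMean G) := by
  rw [gap, le_max_iff, le_max_iff, le_gapOne_iff, le_gapTwo_iff, le_gapZero_iff, or_assoc]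

lemma le_one_of_le_gap {d : ℝ} {G Gstar : I.Group} (hG : G ≠ Gstar) {j : Fin n} (hj : j ∈ G.1)
    (hmean : ∀ j, I.mean j ∈ Set.Icc (0 : ℝ) 1) (hgap : (d : EReal) ≤ I.gap Gstar j) : d ≤ 1 := by
  have hmean_le := (hmean j).2
  have hworst_nonneg := (worstMean_mem_Icc hmean G).1
  have hbest_le := (worstMean_mem_Icc hmean Gstar).2
  obtain hone | htwo | hzero := le_gap_iff.mp hgap
  · linarith [hone G hj]
  · linarith [htwo G hj]
  · linarith [hzero G hG]

end Gaps

section Identification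

variable {n : ℕ} {I : GroupedBandit n} {ε δ : ℝ} {x : Fin n → ℕ → ℝ} {a : ℕ → Fin n}

lemma ConfidenceIntervalsHold.lcb_le_mean (hci : I.ConfidenceIntervalsHold ε δ x) {j : Fin n}
    (hmean : 0 ≤ I.mean j) (t : ℕ) : lcb ε δ x a t j ≤ I.mean j := by
  rw [lcb]
  split_ifs with hpulls
  · exact hmean
  · linarith [(abs_le.mp (hci j _ (Nat.one_le_iff_ne_zero.mpr hpulls))).2]

lemma ConfidenceIntervalsHold.mean_le_ucb (hci : I.ConfidenceIntervalsHold ε δ x) {j : Fin n}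
    (hmean : I.mean j ≤ 1) (t : ℕ) : I.mean j ≤ ucb ε δ x a t j := by
  rw [ucb]
  split_ifs with hpulls
  · exact hmean
  · linarith [(abs_le.mp (hci j _ (Nat.one_le_iff_ne_zero.mpr hpulls))).1]

lemma ConfidenceIntervalsHold.groupMin_lcb_le_worstMean (hci : I.ConfidenceIntervalsHold ε δ x)
    (hmean : ∀ j, 0 ≤ I.mean j) (t : ℕ) (G : I.Group) :
    I.groupMin (lcb ε δ x a t) G ≤ I.worstMean G :=
  groupMin_mono (fun j => hci.lcb_le_mean (hmean j) t) G

lemma ConfidenceIntervalsHold.worstMean_le_groupMin_ucb (hci : I.ConfidenceIntervalsHold ε δ x)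
    (hmean : ∀ j, I.mean j ≤ 1) (t : ℕ) (G : I.Group) :
    I.worstMean G ≤ I.groupMin (ucb ε δ x a t) G :=
  groupMin_mono (fun j => hci.mean_le_ucb (hmean j) t) G

lemma ucb_eq_lcb_add {t : ℕ} {j : Fin n} (hpulls : pulls a t j ≠ 0) :
    ucb ε δ x a t j = lcb ε δ x a t j + 2 * confWidth ε (pulls a t j) (δ / n) := by
  rw [ucb, lcb, if_neg hpulls, if_neg hpulls]
  ring

variable {T t : ℕ} {g : ℕ → I.Group}

lemma IsStableOptRun.ucb_le_groupMin_lcb_add (hrun : I.IsStableOptRun ε δ x T g a)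
    (ht : t ∈ Finset.Icc 1 T) (hpulls : pulls a (t - 1) (a t) ≠ 0) :
    ucb ε δ x a (t - 1) (a t) ≤ I.groupMin (lcb ε δ x a (t - 1)) (g t) +
      2 * confWidth ε (pulls a (t - 1) (a t)) (δ / n) := by
  rw [ucb_eq_lcb_add hpulls]
  gcongr
  exact le_groupMin (hrun.arm_argmin t ht)

lemma IsStableOptRun.worstMean_le_ucb (hrun : I.IsStableOptRun ε δ x T g a)
    (ht : t ∈ Finset.Icc 1 T) (hci : I.ConfidenceIntervalsHold ε δ x)
    (hmean : ∀ j, I.mean j ≤ 1) (H : I.Group) :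
    I.worstMean H ≤ ucb ε δ x a (t - 1) (a t) :=
  calc I.worstMean H ≤ I.groupMin (ucb ε δ x a (t - 1)) H :=
        hci.worstMean_le_groupMin_ucb hmean _ H
    _ ≤ I.groupMin (ucb ε δ x a (t - 1)) (g t) := hrun.group_argmax t ht H
    _ ≤ ucb ε δ x a (t - 1) (a t) := groupMin_le _ (hrun.arm_mem t ht)

lemma IsStableOptRun.worstMean_lt_groupMin_lcb {Gstar G : I.Group} {d : ℝ}
    (hrun : I.IsStableOptRun ε δ x T g a) (ht : t ∈ Finset.Icc 1 T)
    (hci : I.ConfidenceIntervalsHold ε δ x) (hmean : ∀ j, I.mean j ∈ Set.Icc (0 : ℝ) 1)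
    (hgap : (d : EReal) ≤ I.gap Gstar (a t)) (hpulls : pulls a (t - 1) (a t) ≠ 0)
    (hwidth : 2 * confWidth ε (pulls a (t - 1) (a t)) (δ / n) < d) (hG : G ≠ Gstar) :
    I.worstMean G < I.groupMin (lcb ε δ x a (t - 1)) (g t) := by
  have hmem := hrun.arm_mem t ht
  have hcertificate := hrun.ucb_le_groupMin_lcb_add ht hpulls
  have hlower : I.groupMin (lcb ε δ x a (t - 1)) (g t) ≤ I.worstMean (g t) :=
    hci.groupMin_lcb_le_worstMean (fun j => (hmean j).1) _ _
  have hbest : I.worstMean Gstar ≤ ucb ε δ x a (t - 1) (a t) :=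
    hrun.worstMean_le_ucb ht hci (fun j => (hmean j).2) Gstar
  have harm : I.mean (a t) ≤ ucb ε δ x a (t - 1) (a t) := hci.mean_le_ucb (hmean (a t)).2 _
  -- The short interval places `mean (a t)` and the best worst mean less than `d` above
  -- `worstMean (g t)`, so a gap of at least `d` can only come from `Δ₀`.
  obtain hone | htwo | hzero := le_gap_iff.mp hgap
  · linarith [hone _ hmem]
  · linarith [htwo _ hmem]
  · linarith [hzero G hG]

lemma IsStableOptOutput.eq_of_confidenceIntervalsHold {Gstar G : I.Group} {d : ℝ}
    (hout : I.IsStableOptOutput ε δ x T G) (hci : I.ConfidenceIntervalsHold ε δ x)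
    (hmean : ∀ j, I.mean j ∈ Set.Icc (0 : ℝ) 1) (hgap : ∀ j, (d : EReal) ≤ I.gap Gstar j)
    (hT : ∀ k : ℕ, T ≤ n * (k + 1) → k ≠ 0 ∧ 2 * confWidth ε k (δ / n) < d) : G = Gstar := by
  obtain ⟨g, a, hrun, tstar, htstar, hmax, rfl⟩ := hout
  have hT1 : 1 ≤ T := Finset.nonempty_Icc.mp ⟨tstar, htstar⟩
  obtain ⟨t, ht, hle⟩ := exists_round_le_mul_pulls_add_one a hT1
  obtain ⟨hpulls, hwidth⟩ := hT _ hle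
  by_contra hne
  refine lt_irrefl (I.worstMean (g tstar)) ?_
  calc I.worstMean (g tstar) < I.groupMin (lcb ε δ x a (t - 1)) (g t) :=
        hrun.worstMean_lt_groupMin_lcb ht hci hmean (hgap _) hpulls hwidth hne
    _ ≤ I.groupMin (lcb ε δ x a (tstar - 1)) (g tstar) := hmax t ht
    _ ≤ I.worstMean (g tstar) := hci.groupMin_lcb_le_worstMean (fun j => (hmean j).1) _ _

end Identification

section Horizon

/-- The factor `max (1, log log A)` of `mulLogLog A = A * logLogFactor A`, read as `1` for
`A ≤ exp (exp 1)`. -/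
noncomputable def logLogFactor (A : ℝ) : ℝ :=
  Real.log (max (Real.exp 1) (Real.log A))

lemma one_le_logLogFactor (A : ℝ) : 1 ≤ logLogFactor A := by
  rw [logLogFactor, Real.le_log_iff_exp_le (by positivity)]
  exact le_max_left _ _

lemma log_mulLogLog_le {A : ℝ} (hA : 0 < A) :
    Real.log (mulLogLog A) ≤ 2 * max (Real.exp 1) (Real.log A) := by
  have hfactor := one_le_logLogFactor A
  have hlog_factor := Real.log_le_sub_one_of_pos (zero_lt_one.trans_le hfactor)
  have hfactor_le : logLogFactor A ≤ max (Real.exp 1) (Real.log A) - 1 :=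
    Real.log_le_sub_one_of_pos (by positivity)
  have hlog_le : Real.log A ≤ max (Real.exp 1) (Real.log A) := le_max_right _ _
  calc Real.log (mulLogLog A) = Real.log A + Real.log (logLogFactor A) :=
        Real.log_mul hA.ne' (by positivity)
    _ ≤ 2 * max (Real.exp 1) (Real.log A) := by linarith

lemma log_log_mul_mulLogLog_le {A s : ℝ} (hA : 0 < A) (hs : 1 ≤ s) (hsA : 1 < s * mulLogLog A) :
    Real.log (Real.log (s * mulLogLog A)) ≤ 2 + Real.log s + logLogFactor A := by
  set M := max (Real.exp 1) (Real.log A)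
  have hM : 1 ≤ M := (Real.one_le_exp zero_le_one).trans (le_max_left _ _)
  have hmul : 0 < mulLogLog A := mul_pos hA (zero_lt_one.trans_le (one_le_logLogFactor A))
  have hlog : Real.log (s * mulLogLog A) ≤ 3 * (s * M) := by
    have hlog_s := Real.log_le_sub_one_of_pos (zero_lt_one.trans_le hs)
    have hlog_mul : Real.log (mulLogLog A) ≤ 2 * M := log_mulLogLog_le hA
    rw [Real.log_mul (by positivity) hmul.ne']
    nlinarith
  have hlog_three : Real.log 3 ≤ 3 - 1 := Real.log_le_sub_one_of_pos (by norm_num)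
  calc Real.log (Real.log (s * mulLogLog A)) ≤ Real.log (3 * (s * M)) :=
        Real.log_le_log (Real.log_pos hsA) hlog
    _ = Real.log 3 + (Real.log s + logLogFactor A) := by
        rw [Real.log_mul (by norm_num) (by positivity),
          Real.log_mul (by positivity) (by positivity), logLogFactor]
    _ ≤ 2 + Real.log s + logLogFactor A := by linarith

lemma log_two_mul_le {r : ℝ} (hr : 0 < r) : Real.log (2 * r) ≤ r / 32 + 4 := by
  have hscaled : Real.log (r / 32) ≤ r / 32 - 1 := Real.log_le_sub_one_of_pos (by positivity)
  have hlog : Real.log (2 * r) = 6 * Real.log 2 + Real.log (r / 32) := by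
    rw [show 2 * r = 2 ^ 6 * (r / 32) by ring, Real.log_mul (by norm_num) (by positivity),
      Real.log_pow]
    norm_num
  linarith [Real.log_two_lt_d9]

lemma log_log_le_of_le_two_mul_mulLogLog {A r y : ℝ} (hA : 0 < A) (hr : 1 ≤ r) (hy : 1 < y)
    (hyA : y ≤ 2 * r * mulLogLog A) : Real.log (Real.log y) ≤ 6 + r / 32 + logLogFactor A :=
  calc Real.log (Real.log y) ≤ Real.log (Real.log (2 * r * mulLogLog A)) :=
        Real.log_le_log (Real.log_pos hy) (Real.log_le_log (by positivity) hyA)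
    _ ≤ 2 + Real.log (2 * r) + logLogFactor A :=
        log_log_mul_mulLogLog_le hA (by linarith) (hy.trans_le hyA)
    _ ≤ 6 + r / 32 + logLogFactor A := by linarith [log_two_mul_le (r := r) (by linarith)]

variable {ε δ d e : ℝ} {n k T : ℕ}

lemma two_mul_confWidth_lt_of_log_le (hε : ε ∈ Set.Ioo (0 : ℝ) 1) (hk : (0 : ℝ) < k) (hd : 0 < d)
    {V : ℝ} (hV : 0 ≤ V) (hlog : Real.log (Real.log ((1 + ε) * k) / e) ≤ V)
    (hkey : 16 * V < d ^ 2 * k) : 2 * confWidth ε k e < d := by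
  obtain ⟨hε0, hε1⟩ := hε
  have hsqrt : √((1 + ε) / (2 * k) * Real.log (Real.log ((1 + ε) * k) / e)) < d / 4 := by
    rw [Real.sqrt_lt' (by positivity)]
    calc (1 + ε) / (2 * k) * Real.log (Real.log ((1 + ε) * k) / e)
        ≤ (1 + ε) / (2 * k) * V := by gcongr
      _ ≤ (1 + 1) / (2 * k) * V := by gcongr
      _ < (d / 4) ^ 2 := by
        rw [div_mul_eq_mul_div, div_lt_iff₀ (by positivity)]
        linarith
  have hfactor : 1 + √ε ≤ 2 := by linarith [Real.sqrt_le_one.mpr hε1.le]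
  calc 2 * confWidth ε k e
      ≤ 2 * (2 * √((1 + ε) / (2 * k) * Real.log (Real.log ((1 + ε) * k) / e))) := by
        rw [confWidth]
        gcongr
    _ < d := by linarith

lemma two_mul_confWidth_lt (hε : ε ∈ Set.Ioo (0 : ℝ) 1) (he : 0 < e) (hL : 1 ≤ Real.log e⁻¹)
    (hd : 0 < d) {A : ℝ} (hA : Real.log e⁻¹ / d ^ 2 ≤ A)
    (hk : 512 * (Real.log e⁻¹ * logLogFactor A) ≤ d ^ 2 * k) : 2 * confWidth ε k e < d := by
  obtain ⟨hε0, hε1⟩ := hε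
  set L := Real.log e⁻¹
  set ℓ := logLogFactor A
  have hℓ : 1 ≤ ℓ := one_le_logLogFactor A
  have hLℓ : 1 ≤ L * ℓ := one_le_mul_of_one_le_of_one_le hL hℓ
  have hA0 : 0 < A := lt_of_lt_of_le (by positivity) hA
  have hk0 : (0 : ℝ) < k := pos_of_mul_pos_right (by linarith) (sq_nonneg d)
  have hk1 : (1 : ℝ) ≤ k := by exact_mod_cast hk0
  set r := d ^ 2 * k / (L * ℓ) with hr
  have hr512 : 512 ≤ r := (le_div_iff₀ (by positivity)).mpr hk
  have hrk : r * (L * ℓ) = d ^ 2 * k := div_mul_cancel₀ _ (by positivity)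
  have hk_le : (1 + ε) * k ≤ 2 * r * mulLogLog A :=
    calc (1 + ε) * k ≤ 2 * k := by gcongr; linarith
      _ = 2 * r * (L / d ^ 2 * ℓ) := by
        rw [hr]
        field_simp
      _ ≤ 2 * r * (A * ℓ) := by gcongr
  have hεk : 1 < (1 + ε) * k := by nlinarith
  have hloglog : Real.log (Real.log ((1 + ε) * k)) ≤ 6 + r / 32 + ℓ :=
    log_log_le_of_le_two_mul_mulLogLog hA0 (by linarith) hεk hk_le
  have hlog : Real.log (Real.log ((1 + ε) * k) / e) ≤ L + ℓ + 6 + r / 32 := by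
    rw [div_eq_mul_inv, Real.log_mul (Real.log_pos hεk).ne' (inv_pos.mpr he).ne']
    linarith
  refine two_mul_confWidth_lt_of_log_le ⟨hε0, hε1⟩ hk0 hd (by positivity) hlog ?_
  calc 16 * (L + ℓ + 6 + r / 32) ≤ (128 + r / 2) * (L * ℓ) := by nlinarith
    _ < r * (L * ℓ) := by gcongr; linarith
    _ = d ^ 2 * k := hrk

lemma log_mul_logLogFactor_le_of_le_mul_add_one {L A : ℝ} (hn : 0 < n) (hL : 1 ≤ L) (hd : 0 < d)
    (hd1 : d ≤ 1) (hA : A = n * L / d ^ 2) (hT : 1024 * mulLogLog A ≤ T) (hk : T ≤ n * (k + 1)) :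
    512 * (L * logLogFactor A) ≤ d ^ 2 * k := by
  have hn0 : (0 : ℝ) < n := by exact_mod_cast hn
  have hLℓ : 1 ≤ L * logLogFactor A :=
    one_le_mul_of_one_le_of_one_le hL (one_le_logLogFactor A)
  have hd2 : d ^ 2 ≤ 1 := pow_le_one₀ hd.le hd1
  have hTk : (T : ℝ) ≤ n * (k + 1) := by exact_mod_cast hk
  have hscaled : n * (1024 * (L * logLogFactor A)) ≤ n * (d ^ 2 * (k + 1)) :=
    calc n * (1024 * (L * logLogFactor A)) = d ^ 2 * (1024 * (n * L / d ^ 2 * logLogFactor A)) := by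
          field_simp
      _ = d ^ 2 * (1024 * mulLogLog A) := by rw [← hA, mulLogLog, logLogFactor]
      _ ≤ d ^ 2 * (n * (k + 1)) := by gcongr ?_ * ?_; exact hT.trans hTk
      _ = n * (d ^ 2 * (k + 1)) := by ring
  linarith [le_of_mul_le_mul_left hscaled hn0]

lemma ne_zero_and_two_mul_confWidth_lt (hε : ε ∈ Set.Ioo (0 : ℝ) 1) (hn : 0 < n) (hδ : 0 < δ)
    (hL : 1 ≤ Real.log (n / δ)) (hd : 0 < d) (hd1 : d ≤ 1)
    (hT : 1024 * mulLogLog (n * Real.log (n / δ) / d ^ 2) ≤ T) (hk : T ≤ n * (k + 1)) :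
    k ≠ 0 ∧ 2 * confWidth ε k (δ / n) < d := by
  have hn1 : (1 : ℝ) ≤ n := by exact_mod_cast hn
  set A := n * Real.log (n / δ) / d ^ 2 with hA
  have hkey := log_mul_logLogFactor_le_of_le_mul_add_one hn hL hd hd1 hA hT hk
  have hLA : Real.log (n / δ) / d ^ 2 ≤ A := by
    rw [hA]
    gcongr
    exact le_mul_of_one_le_left (by linarith) hn1
  rw [← inv_div δ (n : ℝ)] at hL hLA hkey
  refine ⟨?_, two_mul_confWidth_lt hε (by positivity) hL hd hLA hkey⟩
  rintro rfl
  have hLℓ := one_le_mul_of_one_le_of_one_le hL (one_le_logLogFactor A)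
  rw [Nat.cast_zero, mul_zero] at hkey
  linarith

lemma one_le_log_div_of_mem_Ioo (hn : 0 < n) (hδ : δ ∈ Set.Ioo 0 (Real.log 2 / Real.exp 1)) :
    1 ≤ Real.log (n / δ) := by
  obtain ⟨hδ0, hδ2⟩ := hδ
  have hn1 : (1 : ℝ) ≤ n := by exact_mod_cast hn
  have hδe : δ * Real.exp 1 < Real.log 2 := (lt_div_iff₀ (Real.exp_pos 1)).mp hδ2
  rw [Real.le_log_iff_exp_le (by positivity), le_div_iff₀ hδ0]
  linarith [Real.log_two_lt_d9]

end Horizon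

end GroupedBandit

open GroupedBandit in
theorem mainTheorem3 (ε : ℝ) (hε : ε ∈ Set.Ioo (0 : ℝ) 1) :
    ∃ C : ℝ, 0 < C ∧ ∃ c : ℝ, 0 < c ∧
      ∀ (n : ℕ) (I : GroupedBandit n) (R : ℝ≥0), R ≤ 1 / 2 → I.BoundedSubGaussian R →
      ∀ Gstar : I.Group, I.IsUniqueOptimal Gstar →
      ∀ Δmin : ℝ, 0 < Δmin → (∀ j : Fin n, (Δmin : EReal) ≤ I.gap Gstar j) →
      ∀ δ : ℝ, δ ∈ Set.Ioo (0 : ℝ) (Real.log 2 / Real.exp 1) →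
      ∀ T : ℕ, c * mulLogLog ((n : ℝ) * Real.log ((n : ℝ) / δ) / Δmin ^ 2) ≤ (T : ℝ) →
      ∀ (Ω : Type*) [MeasurableSpace Ω] (P : Measure Ω) [IsProbabilityMeasure P]
        (X : Fin n → ℕ → Ω → ℝ), I.IsRewardTable P X →
      ∀ out : Ω → I.Group,
        (∀ ω, I.IsStableOptOutput ε δ (fun j s => X j s ω) T (out ω)) →
        P.real {ω | out ω ≠ Gstar} ≤ C * δ := by
  refine ⟨2 * failureFactor ε, mul_pos two_pos (failureFactor_pos hε.1), 1024, by norm_num, ?_⟩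
  intro n I R hR hI Gstar _ Δmin hΔ hgap δ hδ T hT Ω _ P _ X hX out hout
  have hn : 0 < n := (I.nonempty_of_mem Gstar.2).choose.pos
  have hfail : {ω | out ω ≠ Gstar} ⊆
      {ω | ¬ I.ConfidenceIntervalsHold ε δ fun j s => X j s ω} := by
    intro ω hne hci
    obtain ⟨j, hj⟩ := I.nonempty_of_mem (out ω).2
    have hΔ1 : Δmin ≤ 1 := le_one_of_le_gap hne hj hI.mean_mem (hgap j)
    exact hne ((hout ω).eq_of_confidenceIntervalsHold hci hI.mean_mem hgap fun _ hk =>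
      ne_zero_and_two_mul_confWidth_lt hε hn hδ.1 (one_le_log_div_of_mem_Ioo hn hδ) hΔ hΔ1 hT hk)
  exact (measureReal_mono hfail).trans
    (measureReal_not_confidenceIntervalsHold_le hR hI hε.1 hδ.1 hX)
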